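/- Let $\Sigma=\{0,\dots,N-1\}$ and let $C\subset\Sigma^3$ be a finite set of triples (a connectivity) such that every symbol of $\Sigma$ occurs in some triple of $C$ and any two triples of $C$ are joined by a chain of triples of $C$ in which consecutive triples have exactly two symbols in common. A triangle mesh with connectivity $C$ is a point $x=(x_0,\dots,x_{N-1})\in(\mathbb{R}^2)^N$ with pairwise distinct $x_k$ such that for $(i_0,i_1,i_2)\in C$ the triangles $(x_{i_0},x_{i_1},x_{i_2})$ are non-degenerate, have their vertices listed counterclockwise, and have pairwise disjoint interiors. For a triangle $p=(p_0,p_1,p_2)$ with centroid $c$ and $r_i=\|p_{i-1}-c\|/\|p_i-c\|$ (indices mod $3$) put $$\theta_i(p)=\tfrac23 r_i(p_i-c)-\tfrac13 r_{i+1}(p_{i+1}-c)-\tfrac13 r_{i-1}(p_{i-1}-c)+c .$$ The mesh transformation $\Theta$ sends $x\in(\mathbb{R}^2)^N$ to the point whose $k$-th entry is the arithmetic mean, over all triangles of $C$ having $k$ as a vertex, of the image $\theta_j$ of the vertex $x_k$ (where $j$ is the position of $k$ in that triangle). It is defined wherever no vertex of a triangle coincides with the centroid of that triangle. Let $M_C$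 be a triangle mesh with connectivity $C$ and $\Theta(M_C)=M_C$, and let $\Lambda$ be its orbit under the group of similarities $p\mapsto\lambda(Ap+b)$, $\lambda>0$, $A\in SO(2)$, $b\in\mathbb{R}^2$, acting simultaneously on all vertices. Suppose that every complex eigenvalue of $D\Theta(M_C)$ that remains after the eigenvalues of the restriction of $D\Theta(M_C)$ to the tangent space $T_{M_C}\Lambda$ have been removed (both counted with algebraic multiplicity) has modulus strictly smaller than $1$. Then $\Lambda$ is an attractor of $\Theta$: $\Theta(\Lambda)=\Lambda$; for every neighborhood $V$ of $\Lambda$ there is a neighborhood $U'$ of $\Lambda$ with $\Theta^n(U')\subset V$ for all $n\ge 0$; and $\operatorname{dist}(\Theta^n(x),\Lambda)\to0$ for all $x$ in some neighborhood of $\Lambda$. Moreover there are an open set $U\supset\Lambda$ and constants $K>0$ and $0<r<1$ such that for every $x\in U$ (in particular for every triangle mesh $x\in U$) all iterates $\Theta^n(x)$ are defined and there is a single point $p\in\Lambda$ with $$\operatorname{dist}(\Theta^n(x),p)\le K r^n\qquad\text{for all } n\ge 0 .$$ -/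

import Mathlib

open Filter Topology

namespace TriMesh

noncomputable section

/-- The Euclidean plane. -/
abbrev Plane : Type := EuclideanSpace ℝ (Fin 2)

/-- A list of `N` points of the plane, i.e. a point of `ℝ ^ (2 * N)`. (The norm is the maximum of
the Euclidean norms of the `N` points, which is equivalent to the Euclidean norm.) -/
abbrev Config (N : ℕ) : Type := Fin N → Plane

/-! ### Connectivities and meshes -/

/-- The set of symbols of a triple. -/
def symbols {N : ℕ} (Δ : Fin 3 → Fin N) : Finset (Fin N) := Finset.univ.image Δ

/-- A finite set of triples of symbols is a connectivity if every symbol occurs in some triple and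
any two triples are joined by a chain of triples, consecutive ones having exactly two symbols in
common. -/
structure IsConnectivity {N : ℕ} (C : Finset (Fin 3 → Fin N)) : Prop where
  covers : ∀ k : Fin N, ∃ Δ ∈ C, ∃ j : Fin 3, Δ j = k
  chain : ∀ Δ ∈ C, ∀ Δ' ∈ C, ∃ (m : ℕ) (s : ℕ → Fin 3 → Fin N),
    m < C.card ∧ s 0 = Δ ∧ s m = Δ' ∧ (∀ i ≤ m, s i ∈ C) ∧
      ∀ i < m, (symbols (s i) ∩ symbols (s (i + 1))).card = 2

/-- Twice the signed area of the triangle `(p 0, p 1, p 2)`; it is positive exactly when the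
triangle is non-degenerate with its vertices listed counterclockwise. -/
def signedArea (p : Fin 3 → Plane) : ℝ :=
  (p 1 0 - p 0 0) * (p 2 1 - p 0 1) - (p 1 1 - p 0 1) * (p 2 0 - p 0 0)

/-- `x` is a triangle mesh with connectivity `C`. -/
structure IsMesh {N : ℕ} (C : Finset (Fin 3 → Fin N)) (x : Config N) : Prop where
  injective : Function.Injective x
  nondegenerate : ∀ Δ ∈ C, 0 < signedArea (x ∘ Δ)
  disjoint_interior : ∀ Δ ∈ C, ∀ Δ' ∈ C, Δ ≠ Δ' →
    Disjoint (interior (convexHull ℝ (Set.range (x ∘ Δ))))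
      (interior (convexHull ℝ (Set.range (x ∘ Δ'))))

/-! ### The triangle transformation and the mesh transformation -/

/-- The centroid of a triangle. -/
def center (p : Fin 3 → Plane) : Plane := (1 / 3 : ℝ) • (p 0 + p 1 + p 2)

/-- The ratio `‖p (i - 1) - c‖ / ‖p i - c‖`, indices modulo 3, with `c` the centroid. -/
def ratio (p : Fin 3 → Plane) (i : Fin 3) : ℝ :=
  ‖p (i - 1) - center p‖ / ‖p i - center p‖

/-- The `i`-th vertex of the transformed triangle, indices modulo 3. -/
def triangleMap (p : Fin 3 → Plane) (i : Fin 3) : Plane :=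
  (2 / 3 * ratio p i) • (p i - center p) - (1 / 3 * ratio p (i + 1)) • (p (i + 1) - center p)
    - (1 / 3 * ratio p (i - 1)) • (p (i - 1) - center p) + center p

/-- The pairs `(Δ, j)` of a triangle of `C` and a position in it at which the symbol `k` stands.
In a mesh a triple has distinct symbols, so these are the triangles adjacent to the vertex `k`. -/
def incidences {N : ℕ} (C : Finset (Fin 3 → Fin N)) (k : Fin N) :
    Finset ((Fin 3 → Fin N) × Fin 3) :=
  (C ×ˢ Finset.univ).filter fun q => q.1 q.2 = k

/-- The mesh transformation: each vertex goes to the mean of its images under the transformations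
of the triangles adjacent to it. -/
def meshMap {N : ℕ} (C : Finset (Fin 3 → Fin N)) (x : Config N) : Config N := fun k =>
  ((incidences C k).card : ℝ)⁻¹ • ∑ q ∈ incidences C k, triangleMap (x ∘ q.1) q.2

/-- The formula of the mesh transformation has no vanishing denominator at `x`. -/
def IsAdmissible {N : ℕ} (C : Finset (Fin 3 → Fin N)) (x : Config N) : Prop :=
  ∀ Δ ∈ C, ∀ j : Fin 3, x (Δ j) ≠ center (x ∘ Δ)

/-! ### Similarities -/

/-- The similarity `p ↦ s (A p + b)` of the plane. -/
def similarity (s : ℝ) (A : Matrix (Fin 2) (Fin 2) ℝ) (b p : Plane) : Plane :=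
  s • (Matrix.toEuclideanLin A p + b)

/-- The orbit of `x` under the group of the similarities `p ↦ s (A p + b)` with `0 < s` and
`A` a rotation, acting on all points simultaneously. -/
def simOrbit {N : ℕ} (x : Config N) : Set (Config N) :=
  {y | ∃ s : ℝ, 0 < s ∧ ∃ A ∈ Matrix.specialOrthogonalGroup (Fin 2) ℝ, ∃ b : Plane,
    y = fun k => similarity s A b (x k)}

/-- The tangent space of the similarity orbit of `x` at `x`. -/
def orbitTangent {N : ℕ} (x : Config N) : Submodule ℝ (Config N) :=
  Submodule.span ℝ (tangentConeAt ℝ (simOrbit x) x)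

/-! ### Equivariance: the orbit of a fixed point consists of fixed points, so the derivative of
the mesh transformation maps the tangent space of the orbit to itself -/

lemma norm_rotation {A : Matrix (Fin 2) (Fin 2) ℝ}
    (hA : A ∈ Matrix.specialOrthogonalGroup (Fin 2) ℝ) (v : Plane) :
    ‖Matrix.toEuclideanLin A v‖ = ‖v‖ := by
  have hA' := (Matrix.mem_specialOrthogonalGroup_iff.1 hA).1
  have h := (Matrix.mem_orthogonalGroup_iff' _ _).1 hA'
  have h00 := congrFun (congrFun h 0) 0
  have h01 := congrFun (congrFun h 0) 1
  have h11 := congrFun (congrFun h 1) 1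
  simp [Matrix.mul_apply, Fin.sum_univ_two] at h00 h01 h11
  rw [EuclideanSpace.norm_eq, EuclideanSpace.norm_eq]
  congr 1
  simp [Fin.sum_univ_two, Matrix.mulVec, dotProduct, sq_abs]
  linear_combination (v 0) ^ 2 * h00 + (v 1) ^ 2 * h11 + 2 * v 0 * v 1 * h01

lemma center_similarity (s : ℝ) (A : Matrix (Fin 2) (Fin 2) ℝ) (b : Plane) (p : Fin 3 → Plane) :
    center (fun i => similarity s A b (p i)) = similarity s A b (center p) := by
  simp only [center, similarity, map_smul, map_add]
  module

lemma similarity_sub (s : ℝ) (A : Matrix (Fin 2) (Fin 2) ℝ) (b p q : Plane) :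
    similarity s A b p - similarity s A b q = s • Matrix.toEuclideanLin A (p - q) := by
  simp only [similarity, map_sub]
  module

lemma ratio_similarity {s : ℝ} (hs : 0 < s) {A : Matrix (Fin 2) (Fin 2) ℝ}
    (hA : A ∈ Matrix.specialOrthogonalGroup (Fin 2) ℝ) (b : Plane) (p : Fin 3 → Plane)
    (i : Fin 3) : ratio (fun i => similarity s A b (p i)) i = ratio p i := by
  simp only [ratio, center_similarity, similarity_sub, norm_smul, norm_rotation hA]
  exact mul_div_mul_left _ _ (norm_ne_zero_iff.2 hs.ne')

lemma triangleMap_similarity {s : ℝ} (hs : 0 < s) {A : Matrix (Fin 2) (Fin 2) ℝ}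
    (hA : A ∈ Matrix.specialOrthogonalGroup (Fin 2) ℝ) (b : Plane) (p : Fin 3 → Plane)
    (i : Fin 3) : triangleMap (fun i => similarity s A b (p i)) i
      = similarity s A b (triangleMap p i) := by
  simp only [triangleMap, center_similarity, similarity_sub, ratio_similarity hs hA]
  simp only [similarity, map_add, map_sub, map_smul]
  module

lemma meshMap_similarity {N : ℕ} {C : Finset (Fin 3 → Fin N)} (hC : IsConnectivity C)
    {s : ℝ} (hs : 0 < s) {A : Matrix (Fin 2) (Fin 2) ℝ}
    (hA : A ∈ Matrix.specialOrthogonalGroup (Fin 2) ℝ) (b : Plane) (x : Config N) :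
    meshMap C (fun k => similarity s A b (x k)) = fun k => similarity s A b (meshMap C x k) := by
  funext k
  have hne : ((incidences C k).card : ℝ) ≠ 0 := by
    obtain ⟨Δ, hΔ, j, hj⟩ := hC.covers k
    have : (Δ, j) ∈ incidences C k := by simp [incidences, hΔ, hj]
    exact_mod_cast (Finset.card_pos.2 ⟨_, this⟩).ne'
  have h : ∀ q : (Fin 3 → Fin N) × Fin 3,
      triangleMap ((fun k => similarity s A b (x k)) ∘ q.1) q.2
        = similarity s A b (triangleMap (x ∘ q.1) q.2) :=
    fun q => triangleMap_similarity hs hA b (x ∘ q.1) q.2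
  simp only [meshMap, h]
  simp only [similarity, map_smul, map_sum, ← Finset.smul_sum, Finset.sum_add_distrib,
    Finset.sum_const, ← Nat.cast_smul_eq_nsmul ℝ, smul_add, smul_smul]
  congr 1
  · rw [mul_comm]
  · rw [mul_left_comm, inv_mul_cancel₀ hne, mul_one]

lemma mem_simOrbit_self {N : ℕ} (x : Config N) : x ∈ simOrbit x :=
  ⟨1, one_pos, 1, one_mem _, 0, by simp [similarity]⟩

lemma meshMap_eq_of_mem_simOrbit {N : ℕ} {C : Finset (Fin 3 → Fin N)} (hC : IsConnectivity C)
    {M : Config N} (hM : meshMap C M = M) {y : Config N} (hy : y ∈ simOrbit M) :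
    meshMap C y = y := by
  obtain ⟨s, hs, A, hA, b, rfl⟩ := hy
  rw [meshMap_similarity hC hs hA, hM]

lemma fderiv_mem_orbitTangent {N : ℕ} {C : Finset (Fin 3 → Fin N)} (hC : IsConnectivity C)
    {M : Config N} (hM : meshMap C M = M) :
    ∀ v ∈ orbitTangent M, (fderiv ℝ (meshMap C) M).toLinearMap v ∈ orbitTangent M := by
  intro v hv
  by_cases hd : DifferentiableAt ℝ (meshMap C) M
  · have h1 : HasFDerivWithinAt (meshMap C) (fderiv ℝ (meshMap C) M) (simOrbit M) M :=
      hd.hasFDerivAt.hasFDerivWithinAt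
    have h2 : HasFDerivWithinAt (meshMap C) (ContinuousLinearMap.id ℝ (Config N))
        (simOrbit M) M :=
      (hasFDerivWithinAt_id M (simOrbit M)).congr
        (fun y hy => meshMap_eq_of_mem_simOrbit hC hM hy) hM
    have h3 := h1.unique_on h2
    have h4 : Set.EqOn (fderiv ℝ (meshMap C) M).toLinearMap
        (LinearMap.id : Config N →ₗ[ℝ] Config N) (orbitTangent M) :=
      LinearMap.eqOn_span fun w hw => h3 hw
    rw [h4 hv]
    exact hv
  · rw [fderiv_zero_of_not_differentiableAt hd]
    exact zero_mem _

/-! ### Spectra and attractors -/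

/-- The complex eigenvalues of a real endomorphism, with algebraic multiplicity. -/
def spec {V : Type*} [AddCommGroup V] [Module ℝ V] [Module.Finite ℝ V] (f : V →ₗ[ℝ] V) :
    Multiset ℂ :=
  f.charpoly.aroots ℂ

/-- The endomorphism of the tangent space of the orbit of the fixed point `M` that the derivative
of the mesh transformation at `M` induces. -/
def tangentDeriv {N : ℕ} {C : Finset (Fin 3 → Fin N)} (hC : IsConnectivity C) {M : Config N}
    (hM : meshMap C M = M) : orbitTangent M →ₗ[ℝ] orbitTangent M :=
  (fderiv ℝ (meshMap C) M).toLinearMap.restrict (fderiv_mem_orbitTangent hC hM)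

/-- The invariant set `Λ` is an attractor of `f`: it is (Lyapunov) stable and attracts all points
of a neighborhood. -/
structure IsAttractor {X : Type*} [PseudoMetricSpace X] (f : X → X) (Λ : Set X) : Prop where
  invariant : f '' Λ = Λ
  stable : ∀ V ∈ 𝓝ˢ Λ, ∃ U ∈ 𝓝ˢ Λ, ∀ n : ℕ, Set.MapsTo f^[n] U V
  attracting : ∃ U ∈ 𝓝ˢ Λ, ∀ x ∈ U,
    Tendsto (fun n : ℕ => Metric.infDist (f^[n] x) Λ) atTop (𝓝 0)

end

end TriMesh

/-!
The orbit `Λ` of `M` consists of fixed points, because the mesh transformation commutes with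
similarities, and it is flat: writing points of the plane as complex numbers, `Λ` is the set of the
configurations `z M + b` with `z ≠ 0`, which is open in a linear subspace. Hence near `M` every point
of `M + T`, where `T` is the tangent space of the orbit at `M`, belongs to `Λ` and is fixed
(`eventually_mem_simOrbit`).

The characteristic polynomial of the derivative `f` of the transformation at `M` is the product of
those of its restriction to `T` and of the endomorphism it induces modulo `T`
(`spec_sub_spec_restrict`). So the hypothesis says that the latter has its spectrum in the open unit
disc, and by Gelfand's formula its powers tend to zero. This gives a seminorm `ν` with kernel `T` that
`f` contracts by a factor `ρ < 1` (`exists_adapted_seminorm`).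

A point `x` near `M` is compared with the fixed point `q ∈ M + T` obtained by projecting `x` along a
complement of `T`. By strict differentiability the image of `x` minus `q` is `f (x - q)` up to a small
multiple of `‖x - q‖`, and `‖x - q‖ ≤ ν (x - M)`. Therefore one step multiplies `ν (x - M)` by at most
some `r < 1` and moves `x` by at most a multiple of `ν (x - M)` (`eventually_seminorm_step_le`).
The steps of an orbit are then summable: it stays near `M` and converges at the rate `r ^ n` to a
point where `ν (· - M)` vanishes, that is, to a point of `Λ` (`exists_geometric_limit`). No invariant
manifold theory is needed, as `Λ` is flat.

Finally, similarities carry this to every point of `Λ`. The bound obtained near `M` is proportional to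
the distance of the starting point from `M`, so its constants do not depend on the scale
(`exists_forall_mem_ball_convergesToOrbit`), although the orbit is not compact.
-/

namespace TriMesh

/-! ### Linear algebra: removing the spectrum of an invariant subspace -/

lemma charpoly_eq_charpoly_restrict_mul_charpoly_mapQ {K V : Type*} [Field K] [Infinite K]
    [AddCommGroup V] [Module K V] [Module.Finite K V] (W : Submodule K V) (f : V →ₗ[K] V)
    (hW : ∀ v ∈ W, f v ∈ W) :
    f.charpoly = (f.restrict hW).charpoly * (W.mapQ W f hW).charpoly := by
  refine Polynomial.funext fun t => ?_
  have ht : W ≤ W.comap (algebraMap K (Module.End K V) t - f) := fun v hv =>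
    W.sub_mem (by simpa [Module.algebraMap_end_apply] using W.smul_mem t hv) (hW v hv)
  have h1 : (algebraMap K (Module.End K V) t - f).restrict ht
      = algebraMap K (Module.End K W) t - f.restrict hW := by
    ext v
    simp [Module.algebraMap_end_apply]
  have h2 : W.mapQ W (algebraMap K (Module.End K V) t - f) ht
      = algebraMap K (Module.End K (V ⧸ W)) t - W.mapQ W f hW := by
    ext v
    simp [Module.algebraMap_end_apply]
  rw [Polynomial.eval_mul, LinearMap.eval_charpoly, LinearMap.eval_charpoly,
    LinearMap.eval_charpoly, LinearMap.det_eq_det_mul_det W _ ht, h1, h2]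

lemma spec_sub_spec_restrict {V : Type*} [AddCommGroup V] [Module ℝ V] [Module.Finite ℝ V]
    (W : Submodule ℝ V) (f : V →ₗ[ℝ] V) (hW : ∀ v ∈ W, f v ∈ W) :
    spec f - spec (f.restrict hW) = spec (W.mapQ W f hW) := by
  have hne : (f.restrict hW).charpoly * (W.mapQ W f hW).charpoly ≠ 0 :=
    mul_ne_zero (LinearMap.charpoly_monic _).ne_zero (LinearMap.charpoly_monic _).ne_zero
  unfold spec
  rw [charpoly_eq_charpoly_restrict_mul_charpoly_mapQ W f hW, Polynomial.aroots_mul hne,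
    add_tsub_cancel_left]

section Gelfand

attribute [local instance] Matrix.linftyOpNormedRing Matrix.linftyOpNormedAlgebra

lemma tendsto_pow_atTop_nhds_zero_of_spectralRadius_lt_one {A : Type*} [NormedRing A]
    [NormedAlgebra ℂ A] [CompleteSpace A] {a : A} (ha : spectralRadius ℂ a < 1) :
    Tendsto (fun k : ℕ => a ^ k) atTop (𝓝 0) := by
  obtain ⟨c, hc, hc1⟩ := exists_between ha
  lift c to NNReal using (hc1.trans ENNReal.one_lt_top).ne
  have h := (spectrum.pow_nnnorm_pow_one_div_tendsto_nhds_spectralRadius a).eventually_lt_const hc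
  have hc1' : (c : ℝ) < 1 := by exact_mod_cast hc1
  refine squeeze_zero_norm' ?_ (tendsto_pow_atTop_nhds_zero_of_lt_one c.2 hc1')
  filter_upwards [h, eventually_gt_atTop 0] with k hk hk0
  have h1 : ((‖a ^ k‖₊ : ENNReal) ^ (1 / k : ℝ)) ^ (k : ℝ) ≤ (c : ENNReal) ^ (k : ℝ) :=
    ENNReal.rpow_le_rpow hk.le (Nat.cast_nonneg k)
  rw [← ENNReal.rpow_mul, one_div, inv_mul_cancel₀ (by positivity), ENNReal.rpow_one,
    ENNReal.rpow_natCast] at h1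
  exact_mod_cast h1

/-- A real matrix all of whose complex eigenvalues lie in the open unit disc has powers tending to
zero, by Gelfand's formula for its complexification. -/
lemma tendsto_matrix_pow_atTop_nhds_zero {n : Type*} [Fintype n] [DecidableEq n]
    (B : Matrix n n ℝ) (hB : ∀ μ ∈ B.charpoly.aroots ℂ, ‖μ‖ < 1) :
    Tendsto (fun k : ℕ => B ^ k) atTop (𝓝 0) := by
  rcases isEmpty_or_nonempty n with hn | hn
  · rw [show (fun k : ℕ => B ^ k) = fun _ => 0 from funext fun k => Subsingleton.elim _ _]
    exact tendsto_const_nhds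
  set D : Matrix n n ℂ := B.map (algebraMap ℝ ℂ) with hD
  have : CompleteSpace (Matrix n n ℂ) := FiniteDimensional.complete ℂ _
  have hrad : spectralRadius ℂ D < 1 := by
    rw [← ENNReal.coe_one]
    refine spectrum.spectralRadius_lt_of_forall_lt D fun μ hμ => ?_
    rw [Matrix.mem_spectrum_iff_isRoot_charpoly, hD, Matrix.charpoly_map] at hμ
    have : μ ∈ B.charpoly.aroots ℂ := by
      rw [Polynomial.mem_aroots']
      refine ⟨((Matrix.charpoly_monic B).map _).ne_zero, ?_⟩
      rwa [Polynomial.aeval_def, Polynomial.eval₂_eq_eval_map]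
    exact_mod_cast hB μ this
  have h := tendsto_pow_atTop_nhds_zero_of_spectralRadius_lt_one hrad
  refine tendsto_pi_nhds.2 fun i => tendsto_pi_nhds.2 fun j => ?_
  have hij := Complex.continuous_re.continuousAt.tendsto.comp
    (tendsto_pi_nhds.1 (tendsto_pi_nhds.1 h i) j)
  refine (hij.congr fun k => ?_).trans (by simp)
  have : D ^ k = (B ^ k).map (algebraMap ℝ ℂ) :=
    (map_pow (algebraMap ℝ ℂ).mapMatrix B k).symm
  simp [this]

end Gelfand

/-- If the endomorphism induced on the quotient by an invariant subspace `W` has its spectrum in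
the open unit disc, then the powers tend to zero after a projection with kernel `W`. -/
lemma exists_projection_comp_pow_tendsto_zero {E : Type*} [NormedAddCommGroup E]
    [NormedSpace ℝ E] [FiniteDimensional ℝ E] (W : Submodule ℝ E) (f : E →L[ℝ] E)
    (hW : ∀ v ∈ W, f v ∈ W) (hspec : ∀ μ ∈ spec (W.mapQ W f.toLinearMap hW), ‖μ‖ < 1) :
    ∃ P : E →L[ℝ] E, (∀ v, P v = 0 ↔ v ∈ W) ∧ (∀ v, P (P v) = P v) ∧
      Tendsto (fun k : ℕ => P ∘L f ^ k) atTop (𝓝 0) := by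
  obtain ⟨s, hs⟩ := W.mkQ.exists_rightInverse_of_surjective W.range_mkQ
  have hs' : ∀ y, W.mkQ (s y) = y := fun y => LinearMap.congr_fun hs y
  have hsinj : Function.Injective s := Function.LeftInverse.injective hs'
  let b := Module.finBasis ℝ (E ⧸ W)
  -- The linear map sending the matrix of an endomorphism `A` of the quotient to `s ∘ A ∘ mkQ`.
  let Φ : Matrix (Fin (Module.finrank ℝ (E ⧸ W))) (Fin (Module.finrank ℝ (E ⧸ W))) ℝ
      →ₗ[ℝ] (E →L[ℝ] E) :=
    { toFun := fun B => LinearMap.toContinuousLinearMap (s ∘ₗ Matrix.toLin b b B ∘ₗ W.mkQ)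
      map_add' := fun B D => by ext v; simp
      map_smul' := fun c B => by ext v; simp }
  have hΦ : Continuous Φ := LinearMap.continuous_of_finiteDimensional Φ
  set A := W.mapQ W f.toLinearMap hW
  have hpow := tendsto_matrix_pow_atTop_nhds_zero (LinearMap.toMatrix b b A) (by
    rwa [LinearMap.charpoly_toMatrix])
  have hlim := (hΦ.tendsto 0).comp hpow
  rw [map_zero] at hlim
  have hAk : ∀ (k : ℕ) (v : E), (A ^ k) (W.mkQ v) = W.mkQ ((f ^ k) v) := by
    intro k
    induction k with
    | zero => intro v; simp
    | succ k ih =>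
      intro v
      rw [pow_succ, pow_succ, Module.End.mul_apply, mul_apply_eq_comp, ← ih]
      rfl
  refine ⟨LinearMap.toContinuousLinearMap (s ∘ₗ W.mkQ), fun v => ?_, fun v => ?_, ?_⟩
  · simp [map_eq_zero_iff s hsinj]
  · simp only [LinearMap.coe_toContinuousLinearMap', LinearMap.comp_apply, hs']
  · refine hlim.congr fun k => ?_
    ext v
    have : Matrix.toLin b b (LinearMap.toMatrix b b A ^ k) = A ^ k := by
      rw [LinearMap.toMatrix_pow, Matrix.toLin_toMatrix]
    change s (Matrix.toLin b b (LinearMap.toMatrix b b A ^ k) (W.mkQ v)) = s (W.mkQ ((f ^ k) v))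
    rw [this, hAk]

/-! ### Dynamics near a linear space of fixed points -/

section Dynamics

variable {E : Type*} [NormedAddCommGroup E] [NormedSpace ℝ E]

/-- An adapted seminorm: if `P ∘ f ^ k → 0`, the seminorm `∑ k < m, ρ⁻ᵏ ‖P (fᵏ v)‖`, for suitable
`m` and `ρ < 1`, vanishes exactly on the kernel of `P` and is contracted by `f` itself. -/
lemma exists_adapted_seminorm (f P : E →L[ℝ] E) (hker : ∀ v, P v = 0 → P (f v) = 0)
    (hPP : ∀ v, P (P v) = P v) (hlim : Tendsto (fun k : ℕ => P ∘L f ^ k) atTop (𝓝 0)) :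
    ∃ (ν : Seminorm ℝ E) (ρ c : ℝ), 0 < ρ ∧ ρ < 1 ∧ 0 < c ∧ (∀ v, ‖P v‖ ≤ ν v) ∧
      (∀ v, ν v ≤ c * ‖P v‖) ∧ ∀ v, ν (f v) ≤ ρ * ν v := by
  have hker' : ∀ (k : ℕ) (v : E), P v = 0 → P ((f ^ k) v) = 0 := by
    intro k
    induction k with
    | zero => intro v hv; simpa using hv
    | succ k ih =>
      intro v hv
      rw [pow_succ, mul_apply_eq_comp]
      exact ih _ (hker v hv)
  have hPk : ∀ (k : ℕ) (v : E), ‖P ((f ^ k) v)‖ ≤ ‖P ∘L f ^ k‖ * ‖P v‖ := by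
    intro k v
    have h := hker' k (v - P v) (by simp [hPP])
    rw [map_sub, map_sub, sub_eq_zero] at h
    rw [h]
    exact (P ∘L f ^ k).le_opNorm (P v)
  obtain ⟨m, hm, hm0⟩ := ((hlim.norm.eventually_le_const (u := 1 / 2) (by simp)).and
    (eventually_gt_atTop 0)).exists
  have hm0' : (1 : ℝ) ≤ m := by exact_mod_cast hm0
  -- By Bernoulli's inequality this `ρ` satisfies `1 / 2 ≤ ρ ^ m`.
  set ρ : ℝ := 1 + (-(1 / (2 * m))) with hρ
  have hinv : 1 / (2 * (m : ℝ)) ≤ 1 / 2 := by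
    apply one_div_le_one_div_of_le <;> linarith
  have hinv0 : 0 < 1 / (2 * (m : ℝ)) := by positivity
  have hρ0 : 0 < ρ := by linarith
  have hρ1 : ρ < 1 := by linarith
  have hρm : 1 / 2 ≤ ρ ^ m := by
    have h := one_add_mul_le_pow (a := -(1 / (2 * (m : ℝ)))) (by linarith) m
    have : 1 + (m : ℝ) * (-(1 / (2 * m))) = 1 / 2 := by field_simp; norm_num
    linarith
  let ν : Seminorm ℝ E := Seminorm.of
    (fun v => ∑ k ∈ Finset.range m, (ρ ^ k)⁻¹ * ‖P ((f ^ k) v)‖)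
    (fun v w => by
      rw [← Finset.sum_add_distrib]
      refine Finset.sum_le_sum fun k _ => ?_
      rw [← mul_add, map_add, map_add]
      exact mul_le_mul_of_nonneg_left (norm_add_le _ _) (by positivity))
    (fun a v => by
      simp only [map_smul, norm_smul, Finset.mul_sum]
      exact Finset.sum_congr rfl fun k _ => by ring)
  have hν : ∀ v, ν v = ∑ k ∈ Finset.range m, (ρ ^ k)⁻¹ * ‖P ((f ^ k) v)‖ := fun v => rfl
  refine ⟨ν, ρ, ∑ k ∈ Finset.range m, (ρ ^ k)⁻¹ * ‖P ∘L f ^ k‖ + 1, hρ0, hρ1, by positivity,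
    fun v => ?_, fun v => ?_, fun v => ?_⟩
  · rw [hν]
    have h := Finset.single_le_sum (f := fun k => (ρ ^ k)⁻¹ * ‖P ((f ^ k) v)‖)
      (fun k _ => by positivity) (Finset.mem_range.2 hm0)
    simpa using h
  · rw [hν, add_mul, Finset.sum_mul]
    refine le_add_of_le_of_nonneg (Finset.sum_le_sum fun k _ => ?_) (by positivity)
    rw [mul_assoc]
    exact mul_le_mul_of_nonneg_left (hPk k v) (by positivity)
  · have hshift : ν (f v) = ρ * ∑ k ∈ Finset.range m,
        (ρ ^ (k + 1))⁻¹ * ‖P ((f ^ (k + 1)) v)‖ := by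
      rw [hν, Finset.mul_sum]
      refine Finset.sum_congr rfl fun k _ => ?_
      rw [pow_succ f, mul_apply_eq_comp]
      field_simp
      ring
    rw [hshift, hν]
    refine mul_le_mul_of_nonneg_left ?_ hρ0.le
    -- The shifted sum loses the term `k = 0` and gains the term `k = m`, which is not larger.
    have h1 := Finset.sum_range_succ (fun k => (ρ ^ k)⁻¹ * ‖P ((f ^ k) v)‖) m
    have h2 := Finset.sum_range_succ' (fun k => (ρ ^ k)⁻¹ * ‖P ((f ^ k) v)‖) m
    have h3 : (ρ ^ m)⁻¹ * ‖P ((f ^ m) v)‖ ≤ (ρ ^ 0)⁻¹ * ‖P ((f ^ 0) v)‖ := by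
      rw [inv_mul_le_iff₀ (by positivity)]
      calc ‖P ((f ^ m) v)‖ ≤ ‖P ∘L f ^ m‖ * ‖P v‖ := hPk m v
        _ ≤ ρ ^ m * ‖P v‖ := mul_le_mul_of_nonneg_right (hm.trans hρm) (norm_nonneg _)
        _ = ρ ^ m * ((ρ ^ 0)⁻¹ * ‖P ((f ^ 0) v)‖) := by simp
    linarith

/-- One step of the map near a fixed point `x₀` through which there is a space `x₀ + ker P` of
fixed points. The point `q = x - P (x - x₀)` is fixed, so strict differentiability compares `F x`
with `q`, the error being proportional to the distance `‖P (x - x₀)‖` of `x` from `q`. -/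
lemma eventually_seminorm_step_le {F : E → E} {f : E →L[ℝ] E} {x₀ : E}
    (hF : HasStrictFDerivAt F f x₀) {P : E →L[ℝ] E} (hPP : ∀ v, P (P v) = P v)
    (hfix : ∀ᶠ q in 𝓝 x₀, P (q - x₀) = 0 → F q = q) {ν : Seminorm ℝ E} {ρ c : ℝ} (hρ0 : 0 < ρ)
    (hρ1 : ρ < 1) (hc : 0 < c) (hPν : ∀ v, ‖P v‖ ≤ ν v) (hνP : ∀ v, ν v ≤ c * ‖P v‖)
    (hνf : ∀ v, ν (f v) ≤ ρ * ν v) :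
    ∃ r B : ℝ, 0 < r ∧ r < 1 ∧ 0 < B ∧ ∀ᶠ x in 𝓝 x₀,
      ν (F x - x₀) ≤ r * ν (x - x₀) ∧ ‖F x - x‖ ≤ B * ν (x - x₀) := by
  have hν0 : ∀ v, P v = 0 → ν v = 0 := fun v hv =>
    le_antisymm (by simpa [hv] using hνP v) (apply_nonneg ν v)
  -- With this `ε` the remainder adds at most `(1 - ρ) / 2` to the contraction factor `ρ`.
  set ε : ℝ := (1 - ρ) / (2 * (c * (‖P‖ + 1))) with hε
  have hε0 : 0 < ε := div_pos (by linarith) (by positivity)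
  have hεc : c * (‖P‖ * ε) ≤ (1 - ρ) / 2 := by
    have h1 : c * ((‖P‖ + 1) * ε) = (1 - ρ) / 2 := by rw [hε]; field_simp
    have h2 : c * (‖P‖ * ε) ≤ c * ((‖P‖ + 1) * ε) := by gcongr; linarith
    linarith
  have hq : Tendsto (fun x => x - P (x - x₀)) (𝓝 x₀) (𝓝 x₀) := by
    have : Continuous fun x => x - P (x - x₀) := by fun_prop
    simpa using this.tendsto x₀
  have hstrict := hF.isLittleO.bound hε0
  have hpair : Tendsto (fun x => (x, x - P (x - x₀))) (𝓝 x₀) (𝓝 (x₀, x₀)) :=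
    tendsto_id.prodMk_nhds hq
  refine ⟨(1 + ρ) / 2, ‖f‖ + ε + 1, by linarith, by linarith, by positivity, ?_⟩
  filter_upwards [hq.eventually hfix, hpair.eventually hstrict] with x hx hR
  set h := P (x - x₀) with hh
  have hqfix : F (x - h) = x - h := hx (by
    rw [show x - h - x₀ = (x - x₀) - h by abel, map_sub, hh, hPP, sub_self])
  simp only [hqfix, sub_sub_cancel] at hR
  set R := F x - (x - h) - f h with hRdef
  have hFx : F x = (x - h) + (f h + R) := by rw [hRdef]; abel
  have hhν : ‖h‖ ≤ ν (x - x₀) := hPν _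
  have hνh : ν h = ν (x - x₀) := by
    have h0 : ν (x - x₀ - h) = 0 := hν0 _ (by rw [map_sub, hh, hPP, sub_self])
    refine le_antisymm ?_ ?_
    · have := map_sub_le_add ν (x - x₀) (x - x₀ - h)
      rw [sub_sub_cancel] at this
      linarith
    · have := map_add_le_add ν (x - x₀ - h) h
      rw [sub_add_cancel] at this
      linarith
  constructor
  · have h0 : ν (x - h - x₀) = 0 := hν0 _ (by
      rw [show x - h - x₀ = (x - x₀) - h by abel, map_sub, hh, hPP, sub_self])
    have e : F x - x₀ = (x - h - x₀) + (f h + R) := by rw [hFx]; abel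
    have hνR : ν R ≤ (1 - ρ) / 2 * ‖h‖ :=
      calc ν R ≤ c * ‖P R‖ := hνP R
        _ ≤ c * (‖P‖ * (ε * ‖h‖)) := by gcongr; exact (P.le_opNorm R).trans (by gcongr)
        _ = c * (‖P‖ * ε) * ‖h‖ := by ring
        _ ≤ (1 - ρ) / 2 * ‖h‖ := by gcongr
    have hνR' : ν R ≤ (1 - ρ) / 2 * ν (x - x₀) :=
      hνR.trans (mul_le_mul_of_nonneg_left hhν (by linarith))
    have h1 := map_add_le_add ν (x - h - x₀) (f h + R)
    have h2 := map_add_le_add ν (f h) R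
    have h3 := hνf h
    rw [hνh] at h3
    rw [e]
    linarith
  · have e : F x - x = f h + R - h := by rw [hFx]; abel
    rw [e]
    calc ‖f h + R - h‖ ≤ ‖f h‖ + ‖R‖ + ‖h‖ :=
          (norm_sub_le _ _).trans (by gcongr; exact norm_add_le _ _)
      _ ≤ ‖f‖ * ‖h‖ + ε * ‖h‖ + ‖h‖ := by gcongr; exact f.le_opNorm h
      _ = (‖f‖ + ε + 1) * ‖h‖ := by ring
      _ ≤ (‖f‖ + ε + 1) * ν (x - x₀) := by gcongr

/-- If near `x₀` a map contracts `ν (· - x₀)` and moves points by at most a multiple of it, then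
orbits starting near `x₀` have summable steps: they stay near `x₀` and converge at a geometric
rate. -/
lemma exists_geometric_limit [CompleteSpace E] {F : E → E} {x₀ : E} {ν : Seminorm ℝ E}
    {r B c : ℝ} (hr0 : 0 < r) (hr1 : r < 1) (hB : 0 < B) (hc : 0 < c) (hνc : ∀ v, ν v ≤ c * ‖v‖)
    (hstep : ∀ᶠ x in 𝓝 x₀, ν (F x - x₀) ≤ r * ν (x - x₀) ∧ ‖F x - x‖ ≤ B * ν (x - x₀))
    {S : Set E} (hS : S ∈ 𝓝 x₀) :
    ∃ δ > 0, ∀ x ∈ Metric.ball x₀ δ, ∃ p ∈ S, ν (p - x₀) = 0 ∧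
      ∀ n : ℕ, F^[n] x ∈ S ∧ dist (F^[n] x) p ≤ B * c / (1 - r) * dist x x₀ * r ^ n := by
  obtain ⟨δ₀, hδ₀, hball⟩ := Metric.eventually_nhds_iff_ball.1 (hstep.and hS)
  have hr1' : 0 < 1 - r := by linarith
  set K := B * c / (1 - r) with hK
  have hK0 : 0 < K := by positivity
  -- Orbits starting in this ball stay within `(K + 1) * dist x x₀ < δ₀` of `x₀`.
  refine ⟨δ₀ / (2 * K + 1), by positivity, fun x hx => ?_⟩
  set d := dist x x₀ with hd
  have hd0 : 0 ≤ d := dist_nonneg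
  have hdδ : (2 * K + 1) * d < δ₀ := by
    rw [Metric.mem_ball, lt_div_iff₀ (by positivity)] at hx
    linarith
  have hνx : ν (x - x₀) ≤ c * d := by rw [hd, dist_eq_norm]; exact hνc _
  have hind : ∀ n : ℕ, ν (F^[n] x - x₀) ≤ r ^ n * (c * d) ∧
      dist x (F^[n] x) ≤ K * d * (1 - r ^ n) := by
    intro n
    induction n with
    | zero => simpa using hνx
    | succ n ih =>
      have hrn : 0 < r ^ n := by positivity
      have hmem : F^[n] x ∈ Metric.ball x₀ δ₀ := by
        have h1 := dist_triangle_left (F^[n] x) x₀ x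
        have h2 : K * d * (1 - r ^ n) ≤ K * d := by
          have : 0 ≤ K * d * r ^ n := by positivity
          linarith
        rw [Metric.mem_ball]
        nlinarith [ih.2, mul_nonneg hK0.le hd0]
      obtain ⟨⟨h1, h2⟩, -⟩ := hball _ hmem
      rw [Function.iterate_succ_apply']
      constructor
      · calc ν (F (F^[n] x) - x₀) ≤ r * ν (F^[n] x - x₀) := h1
          _ ≤ r * (r ^ n * (c * d)) := by gcongr; exact ih.1
          _ = r ^ (n + 1) * (c * d) := by ring
      · have h3 : dist (F^[n] x) (F (F^[n] x)) ≤ B * (r ^ n * (c * d)) := by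
          rw [dist_comm, dist_eq_norm]
          exact h2.trans (by gcongr; exact ih.1)
        have h4 : K * d * (1 - r ^ n) + B * (r ^ n * (c * d)) = K * d * (1 - r ^ (n + 1)) := by
          rw [hK]
          field_simp
          ring
        have h5 := dist_triangle x (F^[n] x) (F (F^[n] x))
        linarith [ih.2]
  have hmem : ∀ n : ℕ, F^[n] x ∈ Metric.closedBall x₀ ((K + 1) * d) := by
    intro n
    have h1 := dist_triangle_left (F^[n] x) x₀ x
    have h2 : 0 ≤ K * d * r ^ n := by positivity
    rw [Metric.mem_closedBall]
    linarith [(hind n).2]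
  have hsub : Metric.closedBall x₀ ((K + 1) * d) ⊆ Metric.ball x₀ δ₀ :=
    Metric.closedBall_subset_ball (by nlinarith [mul_nonneg hK0.le hd0])
  have hgeom : ∀ n : ℕ, dist (F^[n] x) (F^[n + 1] x) ≤ B * (c * d) * r ^ n := by
    intro n
    obtain ⟨⟨-, h2⟩, -⟩ := hball _ (hsub (hmem n))
    rw [Function.iterate_succ_apply', dist_comm, dist_eq_norm]
    calc _ ≤ B * ν (F^[n] x - x₀) := h2
      _ ≤ B * (r ^ n * (c * d)) := by gcongr; exact (hind n).1
      _ = _ := by ring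
  obtain ⟨p, hp⟩ := cauchySeq_tendsto_of_complete (cauchySeq_of_le_geometric r _ hr1 hgeom)
  refine ⟨p, (hball p (hsub (Metric.isClosed_closedBall.mem_of_tendsto hp
    (Eventually.of_forall hmem)))).2, ?_, fun n => ⟨(hball _ (hsub (hmem n))).2, ?_⟩⟩
  · have hνcont : Continuous ν := Seminorm.continuous_of_le
      (q := c.toNNReal • normSeminorm ℝ E)
      (continuous_const.mul continuous_norm)
      fun v => by
        simpa [NNReal.smul_def, Real.coe_toNNReal c hc.le] using hνc v
    have h1 : Tendsto (fun n : ℕ => ν (F^[n] x - x₀)) atTop (𝓝 (ν (p - x₀))) :=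
      (hνcont.tendsto _).comp (hp.sub_const x₀)
    have h2 : Tendsto (fun n : ℕ => r ^ n * (c * d)) atTop (𝓝 0) := by
      simpa using (tendsto_pow_atTop_nhds_zero_of_lt_one hr0.le hr1).mul_const (c * d)
    exact le_antisymm (le_of_tendsto_of_tendsto' h1 h2 fun n => (hind n).1) (apply_nonneg _ _)
  · refine (dist_le_of_le_geometric_of_tendsto r _ hr1 hgeom hp n).trans_eq ?_
    rw [hK]
    ring

/-- A fixed point `x₀` lying in an affine space `x₀ + W` of fixed points, transversally to which the
spectrum of the derivative is in the open unit disc: all nearby orbits converge to a point of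
`x₀ + W`, at a uniform geometric rate and without leaving a prescribed neighborhood. -/
theorem exists_geometric_convergence [FiniteDimensional ℝ E] {F : E → E} {f : E →L[ℝ] E} {x₀ : E}
    (hF : HasStrictFDerivAt F f x₀) (W : Submodule ℝ E) (hW : ∀ v ∈ W, f v ∈ W)
    (hspec : ∀ μ ∈ spec (W.mapQ W f.toLinearMap hW), ‖μ‖ < 1)
    (hfix : ∀ᶠ q in 𝓝 x₀, q - x₀ ∈ W → F q = q) :
    ∃ K r : ℝ, 0 < K ∧ 0 < r ∧ r < 1 ∧ ∀ S ∈ 𝓝 x₀, ∃ δ > 0, ∀ x ∈ Metric.ball x₀ δ, ∃ p ∈ S,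
      p - x₀ ∈ W ∧ ∀ n : ℕ, F^[n] x ∈ S ∧ dist (F^[n] x) p ≤ K * dist x x₀ * r ^ n := by
  have : CompleteSpace E := FiniteDimensional.complete ℝ E
  obtain ⟨P, hPW, hPP, hlim⟩ := exists_projection_comp_pow_tendsto_zero W f hW hspec
  obtain ⟨ν, ρ, c, hρ0, hρ1, hc, hPν, hνP, hνf⟩ := exists_adapted_seminorm f P
    (fun v hv => (hPW _).2 (hW v ((hPW v).1 hv))) hPP hlim
  obtain ⟨r, B, hr0, hr1, hB, hstep⟩ := eventually_seminorm_step_le hF hPP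
    (by simpa only [hPW] using hfix) hρ0 hρ1 hc hPν hνP hνf
  have hc' : 0 < c * (‖P‖ + 1) := by positivity
  have hνc : ∀ v, ν v ≤ c * (‖P‖ + 1) * ‖v‖ := fun v =>
    calc ν v ≤ c * ‖P v‖ := hνP v
      _ ≤ c * (‖P‖ * ‖v‖) := by gcongr; exact P.le_opNorm v
      _ ≤ c * ((‖P‖ + 1) * ‖v‖) := by gcongr; linarith
      _ = _ := by ring
  have hr1' : 0 < 1 - r := by linarith
  refine ⟨B * (c * (‖P‖ + 1)) / (1 - r), r, by positivity, hr0, hr1, fun S hS => ?_⟩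
  obtain ⟨δ, hδ, h⟩ := exists_geometric_limit hr0 hr1 hB hc' hνc hstep hS
  refine ⟨δ, hδ, fun x hx => ?_⟩
  obtain ⟨p, hpS, hp0, hp⟩ := h x hx
  exact ⟨p, hpS, (hPW _).1 (norm_le_zero_iff.1 (hp0 ▸ hPν _)), hp⟩

end Dynamics

/-! ### The orbit and the complex affine images of a configuration -/

/-- The rotation of the plane by a right angle. -/
noncomputable def quarterTurn : Plane →ₗ[ℝ] Plane := Matrix.toEuclideanLin !![0, -1; 1, 0]

/-- The map `(a, c, b) ↦ (k ↦ a x_k + c i x_k + b)`, where `i` is the rotation by a right angle. In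
the complex notation its range consists of the configurations `k ↦ z x_k + b` with `z, b ∈ ℂ`. -/
noncomputable def complexAffineImage {N : ℕ} (x : Config N) : ℝ × ℝ × Plane →ₗ[ℝ] Config N where
  toFun u := fun k => u.1 • x k + u.2.1 • quarterTurn (x k) + u.2.2
  map_add' u v := by funext k; simp; module
  map_smul' s u := by funext k; simp; module

lemma simOrbit_subset_range_complexAffineImage {N : ℕ} (x : Config N) :
    simOrbit x ⊆ LinearMap.range (complexAffineImage x) := by
  rintro _ ⟨s, -, A, hA, b, rfl⟩
  obtain ⟨hO, hdet⟩ := Matrix.mem_specialOrthogonalGroup_iff.1 hA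
  have h := (Matrix.mem_orthogonalGroup_iff _ _).1 hO
  have h' := (Matrix.mem_orthogonalGroup_iff' _ _).1 hO
  have h00 := congrFun (congrFun h 0) 0
  have h01 := congrFun (congrFun h 0) 1
  have h00' := congrFun (congrFun h' 0) 0
  simp [Matrix.mul_apply, Fin.sum_univ_two] at h00 h01 h00'
  rw [Matrix.det_fin_two] at hdet
  -- `A` is multiplication by the complex number `A 0 0 + i A 1 0`.
  have e1 : A 1 1 = A 0 0 := by
    linear_combination -(A 1 1) * h00 + A 0 1 * h01 + A 0 0 * hdet
  have e2 : A 0 1 = -A 1 0 := by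
    linear_combination -(A 1 0) * h00 + A 0 0 * h01 - A 0 1 * hdet
  refine ⟨(s * A 0 0, s * A 1 0, s • b), ?_⟩
  funext k
  ext i
  fin_cases i
  · simp [complexAffineImage, quarterTurn, similarity, Matrix.mulVec, dotProduct,
      Fin.sum_univ_two, e2]
    ring
  · simp [complexAffineImage, quarterTurn, similarity, Matrix.mulVec, dotProduct,
      Fin.sum_univ_two, e1]
    ring

lemma complexAffineImage_mem_simOrbit {N : ℕ} (x : Config N) {a c : ℝ} (h : 0 < a ^ 2 + c ^ 2)
    (b : Plane) : complexAffineImage x (a, c, b) ∈ simOrbit x := by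
  set s := √(a ^ 2 + c ^ 2) with hs
  have hs0 : 0 < s := Real.sqrt_pos.2 h
  have hs2 : s ^ 2 = a ^ 2 + c ^ 2 := Real.sq_sqrt h.le
  refine ⟨s, hs0, !![a / s, -(c / s); c / s, a / s], ?_, s⁻¹ • b, ?_⟩
  · rw [Matrix.mem_specialOrthogonalGroup_iff, Matrix.mem_orthogonalGroup_iff]
    constructor
    · ext i j
      fin_cases i <;> fin_cases j <;>
        simp [Matrix.mul_apply, Fin.sum_univ_two] <;> field_simp <;> linarith
    · rw [Matrix.det_fin_two]
      simp
      field_simp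
      linarith
  · funext k
    ext i
    fin_cases i
    · simp [complexAffineImage, quarterTurn, similarity, Matrix.mulVec, dotProduct,
        Fin.sum_univ_two]
      field_simp
    · simp [complexAffineImage, quarterTurn, similarity, Matrix.mulVec, dotProduct,
        Fin.sum_univ_two]
      field_simp
      ring

/-- A linear form that vanishes on the range of `complexAffineImage x` vanishes on the orbit, hence,
being its own derivative, on the tangent vectors of the orbit. -/
lemma orbitTangent_le_range_complexAffineImage {N : ℕ} (x : Config N) :
    orbitTangent x ≤ LinearMap.range (complexAffineImage x) := by
  refine Submodule.span_le.2 fun v hv => ?_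
  by_contra hvL
  obtain ⟨g, hgv, hg⟩ := Submodule.exists_le_ker_of_notMem hvL
  have hzero : ∀ y ∈ simOrbit x, g y = 0 := fun y hy =>
    hg (simOrbit_subset_range_complexAffineImage x hy)
  have h1 : HasFDerivWithinAt g (LinearMap.toContinuousLinearMap g) (simOrbit x) x :=
    (LinearMap.toContinuousLinearMap g).hasFDerivWithinAt
  have h2 : HasFDerivWithinAt g (0 : Config N →L[ℝ] ℝ) (simOrbit x) x :=
    (hasFDerivWithinAt_const (0 : ℝ) x (simOrbit x)).congr hzero (hzero x (mem_simOrbit_self x))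
  exact hgv (h1.unique_on h2 hv)

/-- The orbit of a nonconstant configuration `x` is locally flat: near `x` it coincides with the
range of `complexAffineImage x`, of which it misses only the constant configurations. -/
lemma eventually_mem_simOrbit {N : ℕ} {x : Config N} {i j : Fin N} (hij : x i ≠ x j) :
    ∀ᶠ y in 𝓝 x, y - x ∈ orbitTangent x → y ∈ simOrbit x := by
  have hopen : ∀ᶠ y : Config N in 𝓝 x, y i ≠ y j :=
    (isOpen_ne_fun (continuous_apply i) (continuous_apply j)).mem_nhds hij
  filter_upwards [hopen] with y hy hyx
  have hx : x ∈ LinearMap.range (complexAffineImage x) :=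
    simOrbit_subset_range_complexAffineImage x (mem_simOrbit_self x)
  have hyL := Submodule.add_mem _ (orbitTangent_le_range_complexAffineImage x hyx) hx
  rw [sub_add_cancel] at hyL
  obtain ⟨⟨a, c, b⟩, rfl⟩ := hyL
  refine complexAffineImage_mem_simOrbit x ?_ b
  by_contra hac
  have ha : a = 0 := by nlinarith [sq_nonneg a, sq_nonneg c]
  have hc : c = 0 := by nlinarith [sq_nonneg a, sq_nonneg c]
  exact hy (by simp [complexAffineImage, ha, hc])

/-! ### Regularity of the mesh transformation -/

lemma ne_center_of_signedArea_pos {p : Fin 3 → Plane} (hp : 0 < signedArea p) (j : Fin 3) :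
    p j ≠ center p := by
  intro h
  have h0 := congrArg (fun v : Plane => v 0) h
  have h1 := congrArg (fun v : Plane => v 1) h
  simp only [center, PiLp.smul_apply, PiLp.add_apply, smul_eq_mul] at h0 h1
  refine hp.ne' ?_
  unfold signedArea
  fin_cases j
  · simp only [Fin.zero_eta] at h0 h1
    have e0 : p 2 0 - p 0 0 = -(p 1 0 - p 0 0) := by linarith
    have e1 : p 2 1 - p 0 1 = -(p 1 1 - p 0 1) := by linarith
    rw [e0, e1]
    ring
  · simp only [Fin.mk_one] at h0 h1
    have e0 : p 2 0 - p 0 0 = 2 * (p 1 0 - p 0 0) := by linarith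
    have e1 : p 2 1 - p 0 1 = 2 * (p 1 1 - p 0 1) := by linarith
    rw [e0, e1]
    ring
  · simp only [Fin.reduceFinMk] at h0 h1
    have e0 : p 1 0 - p 0 0 = 2 * (p 2 0 - p 0 0) := by linarith
    have e1 : p 1 1 - p 0 1 = 2 * (p 2 1 - p 0 1) := by linarith
    rw [e0, e1]
    ring

lemma IsMesh.isAdmissible {N : ℕ} {C : Finset (Fin 3 → Fin N)} {x : Config N} (hx : IsMesh C x) :
    IsAdmissible C x :=
  fun Δ hΔ j => ne_center_of_signedArea_pos (hx.nondegenerate Δ hΔ) j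

lemma contDiff_center_comp {N : ℕ} (Δ : Fin 3 → Fin N) :
    ContDiff ℝ 1 fun x : Config N => center (x ∘ Δ) := by
  unfold center
  simp only [Function.comp_apply]
  fun_prop

lemma isOpen_setOf_isAdmissible {N : ℕ} (C : Finset (Fin 3 → Fin N)) :
    IsOpen {x : Config N | IsAdmissible C x} := by
  simp only [IsAdmissible, Set.ofPred_forall]
  refine isOpen_biInter_finset fun Δ _ => isOpen_iInter_of_finite fun j => ?_
  exact isOpen_ne_fun (continuous_apply (Δ j)) (contDiff_center_comp Δ).continuous

lemma contDiffAt_ratio_comp {N : ℕ} {Δ : Fin 3 → Fin N} {x : Config N}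
    (hx : ∀ j : Fin 3, x (Δ j) ≠ center (x ∘ Δ)) (i : Fin 3) :
    ContDiffAt ℝ 1 (fun y : Config N => ratio (y ∘ Δ) i) x := by
  have hnorm : ∀ j, ContDiffAt ℝ 1 (fun y : Config N => ‖y (Δ j) - center (y ∘ Δ)‖) x := fun j =>
    ContDiffAt.norm ℝ
      ((contDiff_apply ℝ Plane (Δ j)).contDiffAt.sub (contDiff_center_comp Δ).contDiffAt)
      (sub_ne_zero.2 (hx j))
  exact (hnorm (i - 1)).div (hnorm i) (norm_ne_zero_iff.2 (sub_ne_zero.2 (hx i)))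

lemma IsAdmissible.contDiffAt_meshMap {N : ℕ} {C : Finset (Fin 3 → Fin N)} {x : Config N}
    (hx : IsAdmissible C x) : ContDiffAt ℝ 1 (meshMap C) x := by
  refine contDiffAt_pi.2 fun k => ContDiffAt.const_smul _ (ContDiffAt.sum fun q hq => ?_)
  have hq' : q.1 ∈ C := (Finset.mem_product.1 (Finset.mem_filter.1 hq).1).1
  have hr := contDiffAt_ratio_comp (hx q.1 hq')
  have hc : ContDiffAt ℝ 1 (fun y : Config N => center (y ∘ q.1)) x :=
    (contDiff_center_comp q.1).contDiffAt
  have hv : ∀ j, ContDiffAt ℝ 1 (fun y : Config N => y (q.1 j) - center (y ∘ q.1)) x := fun j =>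
    (contDiff_apply ℝ Plane (q.1 j)).contDiffAt.sub hc
  exact ((((contDiffAt_const.mul (hr _)).smul (hv _)).sub
    ((contDiffAt_const.mul (hr _)).smul (hv _))).sub
    ((contDiffAt_const.mul (hr _)).smul (hv _))).add hc

/-! ### Transport along the orbit -/

lemma dist_similarity {N : ℕ} {s : ℝ} (hs : 0 < s) {A : Matrix (Fin 2) (Fin 2) ℝ}
    (hA : A ∈ Matrix.specialOrthogonalGroup (Fin 2) ℝ) (b : Plane) (x y : Config N) :
    dist (fun k => similarity s A b (x k)) (fun k => similarity s A b (y k)) = s * dist x y := by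
  have h : (fun k => similarity s A b (x k)) - (fun k => similarity s A b (y k))
      = s • fun k => Matrix.toEuclideanLin A (x k - y k) := by
    funext k
    exact similarity_sub s A b (x k) (y k)
  rw [dist_eq_norm, h, norm_smul, Real.norm_of_nonneg hs.le, dist_eq_norm]
  congr 1
  simp only [Pi.norm_def, Pi.sub_apply]
  congr 2
  funext k
  exact NNReal.eq (norm_rotation hA _)

lemma exists_similarity_eq {s : ℝ} (hs : 0 < s) {A : Matrix (Fin 2) (Fin 2) ℝ}
    (hA : A ∈ Matrix.specialOrthogonalGroup (Fin 2) ℝ) (b q : Plane) :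
    ∃ p, similarity s A b p = q := by
  have hA' : A * star A = 1 :=
    (Matrix.mem_orthogonalGroup_iff _ _).1 (Matrix.mem_specialOrthogonalGroup_iff.1 hA).1
  refine ⟨Matrix.toEuclideanLin (star A) (s⁻¹ • q - b), ?_⟩
  have h : Matrix.toEuclideanLin A (Matrix.toEuclideanLin (star A) (s⁻¹ • q - b))
      = s⁻¹ • q - b := by
    simp only [Matrix.toLpLin_apply, Matrix.mulVec_mulVec, hA', Matrix.one_mulVec]
  rw [similarity, h, sub_add_cancel, smul_inv_smul₀ hs.ne']

lemma similarity_comp_mem_simOrbit {N : ℕ} {s : ℝ} (hs : 0 < s) {A : Matrix (Fin 2) (Fin 2) ℝ}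
    (hA : A ∈ Matrix.specialOrthogonalGroup (Fin 2) ℝ) (b : Plane) {x y : Config N}
    (hy : y ∈ simOrbit x) : (fun k => similarity s A b (y k)) ∈ simOrbit x := by
  obtain ⟨t, ht, B, hB, d, rfl⟩ := hy
  refine ⟨s * t, mul_pos hs ht, A * B, mul_mem hA hB,
    Matrix.toEuclideanLin A d + t⁻¹ • b, ?_⟩
  funext k
  have h : Matrix.toEuclideanLin (A * B) (x k)
      = Matrix.toEuclideanLin A (Matrix.toEuclideanLin B (x k)) := by
    simp only [Matrix.toLpLin_apply, Matrix.mulVec_mulVec]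
  simp only [similarity, map_smul, map_add, h, smul_add, smul_smul]
  rw [mul_assoc s t t⁻¹, mul_inv_cancel₀ ht.ne', mul_one, add_assoc]

lemma IsAdmissible.similarity_comp {N : ℕ} {C : Finset (Fin 3 → Fin N)} {x : Config N}
    (hx : IsAdmissible C x) {s : ℝ} (hs : 0 < s) {A : Matrix (Fin 2) (Fin 2) ℝ}
    (hA : A ∈ Matrix.specialOrthogonalGroup (Fin 2) ℝ) (b : Plane) :
    IsAdmissible C fun k => similarity s A b (x k) := by
  intro Δ hΔ j h
  have h' : similarity s A b (x (Δ j)) - similarity s A b (center (x ∘ Δ)) = 0 :=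
    sub_eq_zero.2 (h.trans (center_similarity s A b (x ∘ Δ)))
  rw [similarity_sub, smul_eq_zero_iff_right hs.ne', ← norm_eq_zero, norm_rotation hA,
    norm_eq_zero, sub_eq_zero] at h'
  exact hx Δ hΔ j h'

lemma iterate_meshMap_similarity {N : ℕ} {C : Finset (Fin 3 → Fin N)} (hC : IsConnectivity C)
    {s : ℝ} (hs : 0 < s) {A : Matrix (Fin 2) (Fin 2) ℝ}
    (hA : A ∈ Matrix.specialOrthogonalGroup (Fin 2) ℝ) (b : Plane) (x : Config N) (n : ℕ) :
    (meshMap C)^[n] (fun k => similarity s A b (x k))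
      = fun k => similarity s A b ((meshMap C)^[n] x k) := by
  induction n with
  | zero => rfl
  | succ n ih => rw [Function.iterate_succ_apply', ih, meshMap_similarity hC hs hA,
      Function.iterate_succ_apply']

/-- `x` converges under the mesh transformation to a point of the orbit of `M`, all iterates being
defined and the distances being at most `a * r ^ n`. -/
def ConvergesToOrbit {N : ℕ} (C : Finset (Fin 3 → Fin N)) (M : Config N) (a r : ℝ)
    (x : Config N) : Prop :=
  (∀ n : ℕ, IsAdmissible C ((meshMap C)^[n] x)) ∧
    ∃ p ∈ simOrbit M, ∀ n : ℕ, dist ((meshMap C)^[n] x) p ≤ a * r ^ n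

/-- Convergence near `M` is transported to every point `q` of the orbit; since the bound is
proportional to the distance from `q`, the constants `K` and `r` do not depend on `q`. -/
lemma exists_forall_mem_ball_convergesToOrbit {N : ℕ} {C : Finset (Fin 3 → Fin N)}
    (hC : IsConnectivity C) {M : Config N} {K r δ : ℝ} (hδ : 0 < δ)
    (h : ∀ x ∈ Metric.ball M δ, ConvergesToOrbit C M (K * dist x M) r x) {q : Config N}
    (hq : q ∈ simOrbit M) :
    ∃ η > 0, ∀ x ∈ Metric.ball q η, ConvergesToOrbit C M (K * dist x q) r x := by
  obtain ⟨s, hs, A, hA, b, rfl⟩ := hq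
  refine ⟨s * δ, by positivity, fun x hx => ?_⟩
  choose g hg using exists_similarity_eq hs hA b
  obtain ⟨y, rfl⟩ : ∃ y : Config N, (fun k => similarity s A b (y k)) = x :=
    ⟨fun k => g (x k), funext fun k => hg _⟩
  rw [Metric.mem_ball, dist_similarity hs hA, mul_lt_mul_iff_right₀ hs] at hx
  obtain ⟨hadm, p, hp, hdist⟩ := h y hx
  refine ⟨fun n => ?_, _, similarity_comp_mem_simOrbit hs hA b hp, fun n => ?_⟩
  · rw [iterate_meshMap_similarity hC hs hA]
    exact (hadm n).similarity_comp hs hA b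
  · rw [iterate_meshMap_similarity hC hs hA, dist_similarity hs hA, dist_similarity hs hA]
    calc s * dist ((meshMap C)^[n] y) p ≤ s * (K * dist y M * r ^ n) := by
          gcongr; exact hdist n
      _ = K * (s * dist y M) * r ^ n := by ring

/-- The uniform convergence near each point of the orbit makes the orbit an attractor. -/
lemma isAttractor_simOrbit {N : ℕ} {C : Finset (Fin 3 → Fin N)} (hC : IsConnectivity C)
    {M : Config N} (hM : meshMap C M = M) {K r : ℝ} (hK : 0 < K) (hr0 : 0 < r) (hr1 : r < 1)
    (h : ∀ q ∈ simOrbit M, ∃ η > 0, ∀ x ∈ Metric.ball q η,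
      ConvergesToOrbit C M (K * dist x q) r x) :
    IsAttractor (meshMap C) (simOrbit M) where
  invariant := by
    rw [Set.image_congr fun y hy => meshMap_eq_of_mem_simOrbit hC hM hy, Set.image_id']
  stable := by
    intro V hV
    refine ⟨{x | ∀ n : ℕ, (meshMap C)^[n] x ∈ V}, ?_, fun n x hx => hx n⟩
    refine mem_nhdsSet_iff_forall.2 fun q hq => ?_
    obtain ⟨η, hη, hconv⟩ := h q hq
    obtain ⟨ε, hε, hεV⟩ := Metric.mem_nhds_iff.1 (mem_nhdsSet_iff_forall.1 hV q hq)
    refine Filter.mem_of_superset (Metric.ball_mem_nhds q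
      (lt_min hη (div_pos hε (by positivity : (0 : ℝ) < 2 * K + 1)))) fun x hx n => hεV ?_
    rw [Metric.mem_ball, lt_min_iff, lt_div_iff₀ (by positivity)] at hx
    obtain ⟨-, p, -, hp⟩ := hconv x hx.1
    have h0 := hp 0
    have hn : dist ((meshMap C)^[n] x) p ≤ K * dist x q :=
      (hp n).trans (mul_le_of_le_one_right (by positivity) (pow_le_one₀ hr0.le hr1.le))
    rw [pow_zero, mul_one, Function.iterate_zero_apply] at h0
    have h1 := dist_triangle ((meshMap C)^[n] x) p q
    have h2 := dist_triangle_left p q x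
    rw [Metric.mem_ball]
    linarith [hx.2]
  attracting := by
    refine ⟨{x | ∃ a, ConvergesToOrbit C M a r x}, ?_, ?_⟩
    · refine mem_nhdsSet_iff_forall.2 fun q hq => ?_
      obtain ⟨η, hη, hconv⟩ := h q hq
      exact Filter.mem_of_superset (Metric.ball_mem_nhds q hη) fun x hx => ⟨_, hconv x hx⟩
    · rintro x ⟨a, -, p, hp, hdist⟩
      refine squeeze_zero (fun n => Metric.infDist_nonneg)
        (fun n => (Metric.infDist_le_dist_of_mem hp).trans (hdist n)) ?_
      simpa using (tendsto_pow_atTop_nhds_zero_of_lt_one hr0.le hr1).const_mul a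

lemma ConvergesToOrbit.mono {N : ℕ} {C : Finset (Fin 3 → Fin N)} {M x : Config N} {a a' r : ℝ}
    (h : ConvergesToOrbit C M a r x) (hr : 0 ≤ r) (ha : a ≤ a') : ConvergesToOrbit C M a' r x := by
  obtain ⟨hadm, p, hp, hdist⟩ := h
  exact ⟨hadm, p, hp, fun n => (hdist n).trans (by gcongr)⟩

/-- The local form of the convergence, near the fixed mesh itself. -/
lemma exists_ball_convergesToOrbit {N : ℕ} {C : Finset (Fin 3 → Fin N)} (hC : IsConnectivity C)
    {M : Config N} (hmesh : IsMesh C M) (hM : meshMap C M = M)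
    (hspec : ∀ μ ∈ spec (fderiv ℝ (meshMap C) M).toLinearMap - spec (tangentDeriv hC hM), ‖μ‖ < 1) :
    ∃ K r δ : ℝ, 0 < K ∧ 0 < r ∧ r < 1 ∧ 0 < δ ∧
      ∀ x ∈ Metric.ball M δ, ConvergesToOrbit C M (K * dist x M) r x := by
  have horbit : ∀ᶠ y in 𝓝 M, y - M ∈ orbitTangent M → y ∈ simOrbit M := by
    rcases N.eq_zero_or_pos with rfl | hN
    · exact Eventually.of_forall fun y _ => Subsingleton.elim M y ▸ mem_simOrbit_self M
    · obtain ⟨Δ, hΔ, -⟩ := hC.covers ⟨0, hN⟩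
      refine eventually_mem_simOrbit (i := Δ 0) (j := Δ 1) fun h => ?_
      have := hmesh.nondegenerate Δ hΔ
      simp [signedArea, h] at this
  have hadm : ∀ᶠ y in 𝓝 M, IsAdmissible C y :=
    (isOpen_setOf_isAdmissible C).mem_nhds hmesh.isAdmissible
  have hstrict : HasStrictFDerivAt (meshMap C) (fderiv ℝ (meshMap C) M) M :=
    hmesh.isAdmissible.contDiffAt_meshMap.hasStrictFDerivAt one_ne_zero
  rw [tangentDeriv, spec_sub_spec_restrict] at hspec
  obtain ⟨K, r, hK, hr0, hr1, h⟩ := exists_geometric_convergence hstrict (orbitTangent M)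
    (fderiv_mem_orbitTangent hC hM) hspec
    (horbit.mono fun y hy hyM => meshMap_eq_of_mem_simOrbit hC hM (hy hyM))
  obtain ⟨δ, hδ, hball⟩ := h _ (horbit.and hadm)
  refine ⟨K, r, δ, hK, hr0, hr1, hδ, fun x hx => ?_⟩
  obtain ⟨p, hpS, hpM, hp⟩ := hball x hx
  exact ⟨fun n => (hp n).1.2, p, hpS.1 hpM, fun n => (hp n).2⟩

end TriMesh

theorem mainTheorem5 {N : ℕ} (C : Finset (Fin 3 → Fin N)) (hC : TriMesh.IsConnectivity C)
    (M : TriMesh.Config N) (hmesh : TriMesh.IsMesh C M) (hM : TriMesh.meshMap C M = M)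
    (hspec : ∀ μ ∈ TriMesh.spec (fderiv ℝ (TriMesh.meshMap C) M).toLinearMap
        - TriMesh.spec (TriMesh.tangentDeriv hC hM), ‖μ‖ < 1) :
    TriMesh.IsAttractor (TriMesh.meshMap C) (TriMesh.simOrbit M) ∧
    ∃ U : Set (TriMesh.Config N), IsOpen U ∧ TriMesh.simOrbit M ⊆ U ∧
      ∃ K : ℝ, 0 < K ∧ ∃ r : ℝ, 0 < r ∧ r < 1 ∧
        ∀ x ∈ U, (∀ n : ℕ, TriMesh.IsAdmissible C ((TriMesh.meshMap C)^[n] x)) ∧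
          ∃ p ∈ TriMesh.simOrbit M, ∀ n : ℕ,
            dist ((TriMesh.meshMap C)^[n] x) p ≤ K * r ^ n := by
  obtain ⟨K, r, δ, hK, hr0, hr1, hδ, hloc⟩ :=
    TriMesh.exists_ball_convergesToOrbit hC hmesh hM hspec
  have h := fun q hq => TriMesh.exists_forall_mem_ball_convergesToOrbit (q := q) hC hδ hloc hq
  refine ⟨TriMesh.isAttractor_simOrbit hC hM hK hr0 hr1 h,
    interior {x | TriMesh.ConvergesToOrbit C M K r x}, isOpen_interior, fun q hq => ?_, K, hK, r,
    hr0, hr1, fun x hx => interior_subset (s := {x | TriMesh.ConvergesToOrbit C M K r x}) hx⟩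
  obtain ⟨η, hη, hconv⟩ := h q hq
  -- Points within distance `1` of `q` satisfy the bound with the constant `K` itself.
  refine mem_interior_iff_mem_nhds.2 (Filter.mem_of_superset
    (Metric.ball_mem_nhds q (lt_min hη one_pos)) fun x hx => ?_)
  rw [Metric.mem_ball, lt_min_iff] at hx
  exact (hconv x hx.1).mono hr0.le (mul_le_of_le_one_right hK.le hx.2.le)
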